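/- For $n\ge 1$ let $Mb_n$ be the set of crossingless connections of $2n$ labelled marked points on the boundary circle of a Möbius band, i.e. the isotopy classes (fixing the marked points) of families of $n$ pairwise disjoint properly embedded arcs in the Möbius band whose endpoints are exactly the $2n$ marked points. Given $m_1,m_2\in Mb_n$, glue the Möbius band containing $m_1$ to a second Möbius band, containing the inversion of $m_2$, along their boundary circles, respecting the labels of the marked points. The result is a Klein bottle with a finite family of pairwise disjoint simple closed curves. Each of these curves is of exactly one of five types: contractible; isotopic to the core of the first Möbius band (it runs through the crosscap of $m_1$ only); isotopic to the core of the second Möbius band; isotopic to the common boundary circle of the two Möbius bands (it separates the two crosscaps); or two-sided and nonseparating (it runs through both crosscaps). Let $\langle m_1,m_2\rangle=d^{a}x^{b}y^{c}z^{e}w^{f}$, where $a,b,c,e,f$ are the numbers of curves of these five types, in this order. The Gram determinant of type $Mb$ is $$D^{(Mb)}_n=D^{(Mb)}_n(d,w,x,y,z)=\det\big(\langle m_i,m_j\rangle\big)_{m_i,m_j\in Mb_n}\in\mathbb{Z}[d,w,x,y,z],$$ and $D^{(Mb)}_0=1$ (there is only the empty connection). **Theorem.** Let $n\ge 1$. If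 $d^2-1$ is invertible, then $\big(D^{(Mb)}_{n-1}\big)^2$ divides $D^{(Mb)}_n$. That is, for every commutative ring $R$ and all $d,w,x,y,z\in R$ such that $d^2-1$ is a unit of $R$, the element $\big(D^{(Mb)}_{n-1}(d,w,x,y,z)\big)^2$ divides $D^{(Mb)}_n(d,w,x,y,z)$ in $R$ (in particular in $R=\mathbb{Z}[d,w,x,y,z][(d^2-1)^{-1}]$). -/

import Mathlib

namespace MobiusGram

/-!
### Crossingless connections on the Möbius band

The universal cover of the Möbius band is the strip `ℝ × [0, 1]`.  The Möbius band is the quotient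
of the strip by the glide reflection `(t, s) ↦ (t + n, 1 - s)`; its boundary circle has length
`2n` and carries the `2n` marked points that are the images of the integer points of the two
boundary lines.  A point `(i, false)` is the integer point `i` of the first boundary line of the
strip, `(i, true)` the integer point `i` of the second one.
-/

/-- The generating deck transformation of the strip over the Möbius band with `2n` marked points,
on the lifts of the marked points. -/
def shift (n : ℕ) (p : ℤ × Bool) : ℤ × Bool := (p.1 + n, !p.2)

/-- The order in which the lifts of the marked points are met along the boundary of the strip:
first the line `false` from left to right, then the line `true` from right to left. -/
def Precedes : ℤ × Bool → ℤ × Bool → Prop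
  | (i, false), (j, false) => i < j
  | (_, false), (_, true) => True
  | (_, true), (_, false) => False
  | (i, true), (j, true) => j < i

/-- A crossingless connection of the `2n` marked points on the boundary of the Möbius band, up to
isotopy fixing the marked points (`n ≥ 1`): the family of `n` disjoint arcs is recorded by the
endpoints of all its lifts to the strip.  These lifts match the lifted marked points in pairs,
the matching is invariant under deck transformations, and two arcs in the strip can be made
disjoint exactly when their endpoints are not interleaved on the boundary. -/
@[ext]
structure Diagram (n : ℕ) where
  /-- The other endpoint of the lifted arc that starts at a given lifted marked point. -/
  mate : ℤ × Bool → ℤ × Bool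
  mate_mate : ∀ p, mate (mate p) = p
  mate_ne : ∀ p, mate p ≠ p
  mate_shift : ∀ p, mate (shift n p) = shift n (mate p)
  noncrossing : ∀ p q, ¬ (Precedes p q ∧ Precedes q (mate p) ∧ Precedes (mate p) (mate q))

/-!
### There are finitely many crossingless connections
-/

theorem Diagram.mate_add {n : ℕ} (f : Diagram n) (i : ℤ) (b : Bool) (k : ℤ) :
    f.mate (i + 2 * n * k, b) = ((f.mate (i, b)).1 + 2 * n * k, (f.mate (i, b)).2) := by
  have step : ∀ (j : ℤ), f.mate (j + 2 * n, b) =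
      ((f.mate (j, b)).1 + 2 * n, (f.mate (j, b)).2) := by
    intro j
    have h1 : f.mate (shift n (shift n (j, b))) = shift n (shift n (f.mate (j, b))) := by
      rw [f.mate_shift, f.mate_shift]
    have h2 : shift n (shift n (j, b)) = (j + 2 * n, b) := by
      simp [shift]; ring
    rw [h2] at h1
    rw [h1]
    simp [shift]; ring
  induction k using Int.induction_on with
  | zero => simp
  | succ k ih =>
    have h := step (i + 2 * n * k)
    rw [ih] at h
    rw [show i + 2 * (n : ℤ) * ((k : ℤ) + 1) = i + 2 * n * k + 2 * n by ring, h]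
    ext <;> simp; ring
  | pred k ih =>
    have h := step (i + 2 * n * (-(k : ℤ) - 1))
    rw [show i + 2 * (n : ℤ) * (-(k : ℤ) - 1) + 2 * n = i + 2 * n * (-k) by ring, ih] at h
    simp only [Prod.mk.injEq] at h
    ext
    · simp only; linarith [h.1]
    · simp only; rw [h.2]

theorem Diagram.mate_bound {n : ℕ} [NeZero n] (f : Diagram n) (i : ℤ) :
    |(f.mate (i, false)).1 - i| ≤ 2 * n := by
  have hn := NeZero.pos n
  obtain ⟨⟨j, b⟩, h⟩ : ∃ q, f.mate (i, false) = q := ⟨_, rfl⟩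
  have h' : f.mate (j, b) = (i, false) := by rw [← h, f.mate_mate]
  rw [h, abs_le]
  cases b
  · constructor
    · by_contra hc
      have hs := f.mate_add j false 1
      rw [h'] at hs
      refine f.noncrossing (j, false) (j + 2 * n * 1, false) ?_
      rw [hs, h']
      simp only [Precedes] at hc ⊢
      refine ⟨?_, ?_, ?_⟩ <;> omega
    · by_contra hc
      have hs := f.mate_add i false 1
      rw [h] at hs
      refine f.noncrossing (i, false) (i + 2 * n * 1, false) ?_
      rw [hs, h]
      simp only [Precedes] at hc ⊢
      refine ⟨?_, ?_, ?_⟩ <;> omega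
  · have hs : f.mate (j + n, false) = (i + n, true) := by
      have := f.mate_shift (j, true)
      rw [h'] at this
      simpa [shift] using this
    constructor
    · by_contra hc
      refine f.noncrossing (j + n, false) (i, false) ?_
      rw [hs, h]
      simp only [Precedes] at hc ⊢
      refine ⟨?_, trivial, ?_⟩ <;> omega
    · by_contra hc
      refine f.noncrossing (i, false) (j + n, false) ?_
      rw [hs, h]
      simp only [Precedes] at hc ⊢
      refine ⟨?_, trivial, ?_⟩ <;> omega

instance (n : ℕ) [NeZero n] : Finite (Diagram n) := by
  have hn : (0 : ℤ) < 2 * n := by have := NeZero.pos n; omega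
  let φ : Diagram n → (Set.Ico (0 : ℤ) (2 * n) →
      (Set.Icc (-(2 * n : ℤ)) (2 * n + 2 * n) ×ˢ (Set.univ : Set Bool) : Set (ℤ × Bool))) :=
    fun f i => ⟨f.mate (i.1, false), by
      have h := abs_le.1 (f.mate_bound i.1)
      have h2 := i.2
      simp only [Set.mem_Ico] at h2
      simp only [Set.mem_prod, Set.mem_Icc, Set.mem_univ, and_true]
      constructor <;> omega⟩
  have : Finite (Set.Icc (-(2 * n : ℤ)) (2 * n + 2 * n) ×ˢ (Set.univ : Set Bool) :
      Set (ℤ × Bool)) := ((Set.finite_Icc _ _).prod Set.finite_univ).to_subtype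
  refine Finite.of_injective φ ?_
  intro f g hfg
  have h0 : ∀ i : ℤ, f.mate (i, false) = g.mate (i, false) := by
    intro i
    have hm : i % (2 * n) ∈ Set.Ico (0 : ℤ) (2 * n) :=
      ⟨Int.emod_nonneg _ hn.ne', Int.emod_lt_of_pos _ hn⟩
    have h1 : f.mate (i % (2 * n), false) = g.mate (i % (2 * n), false) :=
      congrArg Subtype.val (congrFun hfg ⟨_, hm⟩)
    have h2 := f.mate_add (i % (2 * n)) false (i / (2 * n))
    have h3 := g.mate_add (i % (2 * n)) false (i / (2 * n))
    rw [Int.emod_add_mul_ediv] at h2 h3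
    rw [h2, h3, h1]
  ext1
  funext p
  obtain ⟨i, b⟩ := p
  cases b
  · exact h0 i
  · have e : ((i, true) : ℤ × Bool) = shift n (i - n, false) := by simp [shift]
    rw [e, f.mate_shift, g.mate_shift, h0]

noncomputable instance (n : ℕ) [NeZero n] : Fintype (Diagram n) := Fintype.ofFinite _

/-!
### Gluing two Möbius bands to a Klein bottle

Two Möbius bands, glued along their boundary circles, give a Klein bottle.  Its universal cover is
the plane, in which the lines of integer height are the lifts of the common boundary circle; the
lifted marked points are the points of `ℤ × ℤ`, written `(position, height)`.  The strips between
the heights `2m` and `2m + 1` cover the first Möbius band, the strips between the heights `2m - 1`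
and `2m` cover the (inverted) second one; the lines of even height are the lines `false` of both
adjacent strips, those of odd height the lines `true`.
-/

/-- The deck transformation given by the core of the first Möbius band. -/
def deck₁ (n : ℕ) (u : ℤ × ℤ) : ℤ × ℤ := (u.1 + n, 1 - u.2)

/-- The deck transformation given by the core of the second Möbius band. -/
def deck₂ (n : ℕ) (u : ℤ × ℤ) : ℤ × ℤ := (u.1 + n, -1 - u.2)

/-- Two lifted marked points are the endpoints of a lifted arc of `f`, drawn in the first Möbius
band, or of `g`, drawn in the second one. -/
inductive Joined {n : ℕ} (f g : Diagram n) : ℤ × ℤ → ℤ × ℤ → Prop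
  | first (m i j : ℤ) (b c : Bool) (h : f.mate (i, b) = (j, c)) :
      Joined f g (i, 2 * m + b.toNat) (j, 2 * m + c.toNat)
  | second (m i j : ℤ) (b c : Bool) (h : g.mate (i, b) = (j, c)) :
      Joined f g (i, 2 * m - b.toNat) (j, 2 * m - c.toNat)

/-- Two lifted marked points lie on the same component of the preimage, in the universal cover of
the Klein bottle, of the closed curves formed by `f` and `g`. -/
def SameLift {n : ℕ} (f g : Diagram n) : ℤ × ℤ → ℤ × ℤ → Prop :=
  Relation.EqvGen (Joined f g)

/-- Two lifted marked points lie over the same closed curve on the Klein bottle. -/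
def sameCurve {n : ℕ} (f g : Diagram n) : Setoid (ℤ × ℤ) :=
  Relation.EqvGen.setoid fun u v => Joined f g u v ∨ v = deck₁ n u ∨ v = deck₂ n u

/-- The closed curves on the Klein bottle obtained by gluing `f` and `g`. -/
def Curve {n : ℕ} (f g : Diagram n) : Type := Quotient (sameCurve f g)

instance {n : ℕ} [NeZero n] (f g : Diagram n) : Finite (Curve f g) := by
  have hn : (0 : ℤ) < 2 * n := by have := NeZero.pos n; omega
  let q : ℤ × ℤ → Curve f g := fun u => Quotient.mk (sameCurve f g) u
  have h₁ : ∀ u, q (deck₁ n u) = q u := fun u =>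
    (Quotient.sound (s := sameCurve f g) (Relation.EqvGen.rel _ _ (Or.inr (Or.inl rfl)))).symm
  have h₂ : ∀ u, q (deck₂ n u) = q u := fun u =>
    (Quotient.sound (s := sameCurve f g) (Relation.EqvGen.rel _ _ (Or.inr (Or.inr rfl)))).symm
  have hx : ∀ i h : ℤ, q (i + 2 * n, h) = q (i, h) := by
    intro i h
    have e : deck₁ n (deck₁ n (i, h)) = (i + 2 * n, h) := by simp [deck₁]; ring
    rw [← e, h₁, h₁]
  have hy : ∀ i h : ℤ, q (i, h + 2) = q (i, h) := by
    intro i h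
    have a := h₁ (i - n, -1 - h)
    have b := h₂ (i - n, -1 - h)
    have ea : deck₁ n (i - n, -1 - h) = (i, h + 2) := by simp [deck₁]; ring
    have eb : deck₂ n (i - n, -1 - h) = (i, h) := by simp [deck₂]
    rw [ea] at a
    rw [eb] at b
    rw [a, b]
  have hx' : ∀ k i h : ℤ, q (i + 2 * n * k, h) = q (i, h) := by
    intro k
    induction k using Int.induction_on with
    | zero => simp
    | succ k ih =>
      intro i h
      rw [← ih i h, ← hx (i + 2 * n * k)]; congr 2; ring
    | pred k ih =>
      intro i h
      rw [← ih i h, ← hx]; congr 2; ring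
  have hy' : ∀ k i h : ℤ, q (i, h + 2 * k) = q (i, h) := by
    intro k
    induction k using Int.induction_on with
    | zero => simp
    | succ k ih =>
      intro i h
      rw [← ih i h, ← hy i (h + 2 * k)]; congr 2; ring
    | pred k ih =>
      intro i h
      rw [← ih i h, ← hy]; congr 2; ring
  let ψ : (Set.Ico (0 : ℤ) (2 * n) ×ˢ Set.Ico (0 : ℤ) 2 : Set (ℤ × ℤ)) → Curve f g :=
    fun u => q u.1
  have : Finite (Set.Ico (0 : ℤ) (2 * n) ×ˢ Set.Ico (0 : ℤ) 2 : Set (ℤ × ℤ)) :=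
    ((Set.finite_Ico _ _).prod (Set.finite_Ico _ _)).to_subtype
  refine Finite.of_surjective ψ ?_
  intro c
  obtain ⟨⟨i, h⟩, rfl⟩ := Quotient.exists_rep c
  refine ⟨⟨(i % (2 * n), h % 2), ⟨⟨Int.emod_nonneg _ hn.ne', Int.emod_lt_of_pos _ hn⟩,
    ⟨Int.emod_nonneg _ (by norm_num), Int.emod_lt_of_pos _ (by norm_num)⟩⟩⟩, ?_⟩
  change q (i % (2 * n), h % 2) = q (i, h)
  rw [← hx' (i / (2 * n)), ← hy' (h / 2), Int.emod_add_mul_ediv, Int.emod_add_mul_ediv]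

noncomputable instance {n : ℕ} [NeZero n] (f g : Diagram n) : Fintype (Curve f g) :=
  Fintype.ofFinite _

/-- Some lift of the curve `c` is mapped to itself by the deck transformation `γ`. -/
def Curve.Invariant {n : ℕ} {f g : Diagram n} (c : Curve f g) (γ : ℤ × ℤ → ℤ × ℤ) : Prop :=
  ∃ u, Quotient.mk (sameCurve f g) u = c ∧ SameLift f g u (γ u)

open Classical in
/-- The variable of a closed curve.  A simple closed curve on the Klein bottle is isotopic to the
core of the first Möbius band (`x`), to the core of the second one (`y`), to the two-sided
nonseparating curve, which runs once through both crosscaps (`w`; deck transformation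
`deck₁ ∘ deck₂⁻¹`), to the common boundary circle of the two Möbius bands (`z`; deck
transformation `deck₁ ∘ deck₁`), or it is contractible (`d`; its lifts are closed). -/
noncomputable def Curve.weight {R : Type*} {n : ℕ} {f g : Diagram n} (d w x y z : R)
    (c : Curve f g) : R :=
  if c.Invariant (deck₁ n) then x
  else if c.Invariant (deck₂ n) then y
  else if c.Invariant (fun u => (u.1, u.2 + 2)) then w
  else if c.Invariant (fun u => (u.1 + 2 * n, u.2)) then z
  else d

/-- The bilinear form on crossingless connections: the monomial of the closed curves on the Klein
bottle that arise from gluing `f` with the inversion of `g`. -/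
noncomputable def form {R : Type*} [CommRing R] {n : ℕ} [NeZero n] (d w x y z : R)
    (f g : Diagram n) : R :=
  ∏ c : Curve f g, c.weight d w x y z

/-- The Gram matrix of type `Mb`. -/
noncomputable def gramMatrix {R : Type*} [CommRing R] (n : ℕ) [NeZero n] (d w x y z : R) :
    Matrix (Diagram n) (Diagram n) R :=
  Matrix.of fun f g => form d w x y z f g

open Classical in
/-- The Gram determinant of type `Mb`.  Without marked points there is only the empty connection,
and the Gram matrix is `(1)`. -/
noncomputable def gramDet {R : Type*} [CommRing R] : ℕ → R → R → R → R → R → R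
  | 0, _, _, _, _, _ => 1
  | n + 1, d, w, x, y, z => (gramMatrix (n + 1) d w x y z).det

end MobiusGram

/-! Fix two neighbouring marked points `t` and `t + 1`. A short arc inserted between them turns a
connection `f` of size `n` into `insertCup t f` of size `n + 1`. Conversely, joining them outside
the Möbius band turns `g` of size `n + 1` into a connection `h` of size `n` (`exists_isCap`). The
curves formed by `insertCup t f` and `g` are those formed by `f` and `h`, with the same types, plus
one further curve exactly when `g` joins the two points to each other. That curve consists of the
inserted arc and an arc of `g`, so its variable does not depend on `f`. Hence the form of `insertCup
t f` and `g` is the form of `f` and `h` times a factor, with `h` and the factor determined by `t`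
and `g` (`exists_form_insertCup`).

In terms of matrices, the rows `insertCup t f` of the large Gram matrix form a product `G * Q t`,
where `G` is the small one. The inserted arcs for `t = 0` and `t = 1` compete for the marked point
`1`, so the two families of rows are disjoint (`insertCup_ne`). Together they equal `diag(G, G)`
times a matrix, and the determinant of this left factor, the square of `det G`, divides the large
determinant (`det_dvd_det_of_rows`).

The topology is carried out on lifts. Noncrossing becomes the statement that a chord does not
separate the ends of another one (`Diagram.same_side`), which adds up along concatenated chords.
Curves are compared through `Retracts`, which moves each point of a surviving curve to a point that
is not left out, compatibly with arcs and deck transformations. -/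

namespace MobiusGram

/-! ### The order on the lifted marked points -/

theorem Precedes.asymm {p q : ℤ × Bool} (h : Precedes p q) : ¬ Precedes q p := by
  obtain ⟨i, b⟩ := p
  obtain ⟨j, c⟩ := q
  cases b <;> cases c <;> simp only [Precedes] at h ⊢ <;> first | omega | tauto

/-- Noncrossing chords do not separate each other's endpoints. -/
theorem Diagram.same_side {n : ℕ} (f : Diagram n) {p q : ℤ × Bool} (h : q ≠ p)
    (h' : q ≠ f.mate p) :
    (Precedes q p ↔ Precedes q (f.mate p)) ↔
      (Precedes (f.mate q) p ↔ Precedes (f.mate q) (f.mate p)) := by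
  have c₁ := f.noncrossing p q
  have c₂ := f.noncrossing p (f.mate q)
  have c₃ := f.noncrossing (f.mate p) q
  have c₄ := f.noncrossing (f.mate p) (f.mate q)
  have c₅ := f.noncrossing q p
  have c₆ := f.noncrossing q (f.mate p)
  have c₇ := f.noncrossing (f.mate q) p
  have c₈ := f.noncrossing (f.mate q) (f.mate p)
  have n₁ : f.mate q ≠ p := fun e => h' (by rw [← e, f.mate_mate])
  have n₂ : f.mate q ≠ f.mate p := fun e => h (by rw [← f.mate_mate q, e, f.mate_mate])
  simp only [f.mate_mate] at *
  have n₃ := f.mate_ne p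
  have n₄ := f.mate_ne q
  generalize f.mate p = p' at *
  generalize f.mate q = q' at *
  obtain ⟨p, b⟩ := p
  obtain ⟨p', b'⟩ := p'
  obtain ⟨q, c⟩ := q
  obtain ⟨q', c'⟩ := q'
  cases b <;> cases b' <;> cases c <;> cases c' <;>
    simp only [Precedes, ne_eq, Prod.mk.injEq, and_true, and_false, not_false_eq_true,
      true_and, false_and, not_false_eq_true, reduceCtorEq, iff_true, true_iff, iff_false,
      false_iff] at * <;> omega

/-- A matching whose chords do not separate each other's endpoints is noncrossing. -/
def Diagram.ofSameSide {n : ℕ} (mate : ℤ × Bool → ℤ × Bool) (mate_mate : ∀ p, mate (mate p) = p)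
    (mate_ne : ∀ p, mate p ≠ p) (mate_shift : ∀ p, mate (shift n p) = shift n (mate p))
    (side : ∀ p q, q ≠ p → q ≠ mate p → ((Precedes q p ↔ Precedes q (mate p)) ↔
      (Precedes (mate q) p ↔ Precedes (mate q) (mate p)))) : Diagram n where
  mate := mate
  mate_mate := mate_mate
  mate_ne := mate_ne
  mate_shift := mate_shift
  noncrossing := by
    rintro p q ⟨h₁, h₂, h₃⟩
    have h₄ : Precedes p (mate q) := by
      generalize mate p = p' at *
      generalize mate q = q' at *
      obtain ⟨p, b⟩ := p
      obtain ⟨p', b'⟩ := p'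
      obtain ⟨q, c⟩ := q
      obtain ⟨q', c'⟩ := q'
      cases b <;> cases b' <;> cases c <;> cases c' <;> simp only [Precedes] at * <;> omega
    have := side p q (fun e => (e ▸ h₁).asymm (e ▸ h₁)) (fun e => (e ▸ h₂).asymm (e ▸ h₂))
    have a₁ := h₁.asymm
    have a₃ := h₃.asymm
    have a₄ := h₄.asymm
    tauto

/-! ### Deck transformations of the strip -/

/-- The generating deck transformation of the strip as a permutation. -/
def shiftPerm (n : ℕ) : Equiv.Perm (ℤ × Bool) where
  toFun := shift n
  invFun p := (p.1 - n, !p.2)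
  left_inv p := by simp [shift]
  right_inv p := by simp [shift]

theorem shiftPerm_apply (n : ℕ) (p : ℤ × Bool) : shiftPerm n p = shift n p := rfl

theorem shift_injective (n : ℕ) : Function.Injective (shift n) := (shiftPerm n).injective

theorem shiftPerm_zpow_fst (n : ℕ) (k : ℤ) (p : ℤ × Bool) :
    ((shiftPerm n ^ k) p).1 = p.1 + k * n := by
  induction k using Int.induction_on generalizing p with
  | zero => simp
  | succ k ih =>
    rw [zpow_add_one, Equiv.Perm.mul_apply, ih]
    simp only [shiftPerm, shift, Equiv.coe_fn_mk]; ring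
  | pred k ih =>
    rw [zpow_sub_one, Equiv.Perm.mul_apply, ih]
    change p.1 - n + _ = _
    ring

theorem shiftPerm_zpow_two_mul (n : ℕ) (k i : ℤ) (b : Bool) :
    (shiftPerm n ^ (2 * k)) (i, b) = (i + 2 * n * k, b) := by
  have sq : ∀ p : ℤ × Bool, (shiftPerm n ^ (2 : ℤ)) p = (p.1 + 2 * n, p.2) := by
    intro p
    change shift n (shift n p) = _
    ext <;> simp [shift]; ring
  ext
  · rw [shiftPerm_zpow_fst]; simp only; ring
  · rw [zpow_mul]
    simp only
    induction k using Int.induction_on generalizing i with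
    | zero => simp
    | succ k ih => rw [zpow_add_one, Equiv.Perm.mul_apply, sq, ih]
    | pred k ih =>
      rw [zpow_sub_one, Equiv.Perm.mul_apply]
      have : ((shiftPerm n ^ (2 : ℤ))⁻¹) (i, b) = (i - 2 * n, b) := by
        rw [Equiv.Perm.inv_eq_iff_eq, sq]; simp
      rw [this, ih]

theorem Diagram.mate_injective {n : ℕ} (f : Diagram n) : Function.Injective f.mate :=
  Function.LeftInverse.injective f.mate_mate

/-- A map that commutes with the generating deck transformations commutes with all. -/
theorem map_shiftPerm_zpow {m n : ℕ} (φ : ℤ × Bool → ℤ × Bool)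
    (h : ∀ p, φ (shift m p) = shift n (φ p)) (k : ℤ) (p : ℤ × Bool) :
    φ ((shiftPerm m ^ k) p) = (shiftPerm n ^ k) (φ p) := by
  induction k using Int.induction_on generalizing p with
  | zero => simp
  | succ k ih =>
    rw [zpow_add_one, zpow_add_one, Equiv.Perm.mul_apply, Equiv.Perm.mul_apply, ih]
    exact congrArg _ (h p)
  | pred k ih =>
    rw [zpow_sub_one, zpow_sub_one, Equiv.Perm.mul_apply, Equiv.Perm.mul_apply, ih]
    congr 1
    rw [Equiv.Perm.eq_inv_iff_eq, shiftPerm_apply, ← h, ← shiftPerm_apply, ← Equiv.Perm.mul_apply,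
      mul_inv_cancel, Equiv.Perm.one_apply]

/-! ### Making room for two more marked points -/

/-- The embedding of the lifts of `2n` marked points into those of `2n + 2` marked points that
leaves out the marked points `t` and `t + 1`. -/
def spread (n : ℕ) (t : ℤ) (p : ℤ × Bool) : ℤ × Bool :=
  -- The quotient numbers the period of `2n` points, and each period gains two points. On the line
  -- `false` the period starts at `0`, and its image starts at `t + 2`. On the line `true` it starts
  -- at `n`; the extra `1` is the difference between the glide lengths `n + 1` and `n`.
  (p.1 + 2 * ((p.1 - p.2.toNat * n) / (2 * n)) + 2 + p.2.toNat + t, p.2)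

/-- The exchange of the lifts of the marked points `t` and `t + 1`. -/
def partner (n : ℕ) (t : ℤ) (p : ℤ × Bool) : ℤ × Bool :=
  -- The lifts of `t` on the line `true` are shifted by `n + 1`. The value at points other than
  -- lifts of `t` and `t + 1` is a default; it is still a neighbour of `p`.
  (if (2 * (n + 1) : ℤ) ∣ p.1 - p.2.toNat * (n + 1) - t then p.1 + 1 else p.1 - 1, p.2)

section spread

variable {n : ℕ} [NeZero n] {t : ℤ}

theorem two_mul_natCast_pos (n : ℕ) [NeZero n] : (0 : ℤ) < 2 * n := by
  have := NeZero.pos n; omega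

theorem spread_shift (p : ℤ × Bool) : spread n t (shift n p) = shift (n + 1) (spread n t p) := by
  obtain ⟨i, b⟩ := p
  have hn := two_mul_natCast_pos n
  cases b
  · simp [spread, shift]; ring
  · have : (i + n : ℤ) / (2 * n) = (i - n) / (2 * n) + 1 := by
      rw [← Int.add_mul_ediv_left _ _ hn.ne']
      congr 1; ring
    simp [spread, shift, this]; ring

/-- On each boundary line `spread` adds a nondecreasing function of the position, so it is strictly
increasing. -/
theorem spread_precedes (p q : ℤ × Bool) :
    Precedes (spread n t p) (spread n t q) ↔ Precedes p q := by
  obtain ⟨i, b⟩ := p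
  obtain ⟨j, c⟩ := q
  have hn := two_mul_natCast_pos n
  have mono : ∀ {i j s : ℤ}, i ≤ j → (i - s) / (2 * n) ≤ (j - s) / (2 * n) := fun h =>
    Int.ediv_le_ediv hn (by omega)
  cases b <;> cases c <;> simp only [spread, Precedes, Bool.toNat_false, Bool.toNat_true]
  · constructor
    · intro h; by_contra h'
      have := mono (s := (0 : ℕ) * n) (not_lt.1 h'); omega
    · intro h
      have := mono (s := (0 : ℕ) * n) h.le; omega
  · constructor
    · intro h; by_contra h'
      have := mono (s := (1 : ℕ) * n) (not_lt.1 h'); omega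
    · intro h
      have := mono (s := (1 : ℕ) * n) h.le; omega

theorem eq_of_not_precedes {p q : ℤ × Bool} (h : ¬ Precedes p q) (h' : ¬ Precedes q p) :
    p = q := by
  obtain ⟨i, b⟩ := p
  obtain ⟨j, c⟩ := q
  cases b <;> cases c <;> simp only [Precedes, Prod.mk.injEq, and_true] at * <;>
    first | omega | tauto

theorem spread_injective : Function.Injective (spread n t) := by
  intro p q h
  refine eq_of_not_precedes (fun h' => ?_) (fun h' => ?_) <;>
  · rw [← spread_precedes (n := n) (t := t), h] at h'
    exact h'.asymm h'

theorem spread_ne_zero (q : ℤ × Bool) : spread n t q ≠ (t, false) := by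
  obtain ⟨i, b⟩ := q
  rintro h
  have hn := two_mul_natCast_pos n
  simp only [spread, Prod.mk.injEq] at h
  obtain ⟨h, rfl⟩ := h
  have h₁ := Int.emod_add_mul_ediv (i - (0 : ℕ) * n) (2 * n)
  have h₂ := Int.emod_nonneg (i - (0 : ℕ) * n) hn.ne'
  have h₃ := Int.emod_lt_of_pos (i - (0 : ℕ) * n) hn
  simp only [Bool.toNat_false] at h
  generalize (i - (0 : ℕ) * n) / (2 * n) = k at *
  -- Periods `k ≥ 0` land at `t + 2` or later, negative ones at `t - 1` or earlier.
  rcases le_or_gt 0 k with hk | hk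
  · have := mul_nonneg hn.le hk; omega
  · have := mul_le_mul_of_nonneg_left (show k ≤ -1 by omega) hn.le; omega

theorem spread_ne_one (q : ℤ × Bool) : spread n t q ≠ (t + 1, false) := by
  obtain ⟨i, b⟩ := q
  rintro h
  have hn := two_mul_natCast_pos n
  simp only [spread, Prod.mk.injEq] at h
  obtain ⟨h, rfl⟩ := h
  have h₁ := Int.emod_add_mul_ediv (i - (0 : ℕ) * n) (2 * n)
  have h₂ := Int.emod_nonneg (i - (0 : ℕ) * n) hn.ne'
  have h₃ := Int.emod_lt_of_pos (i - (0 : ℕ) * n) hn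
  simp only [Bool.toNat_false] at h
  generalize (i - (0 : ℕ) * n) / (2 * n) = k at *
  rcases le_or_gt 0 k with hk | hk
  · have := mul_nonneg hn.le hk; omega
  · have := mul_le_mul_of_nonneg_left (show k ≤ -1 by omega) hn.le; omega

theorem zpow_mem_range_spread {k : ℤ} {p : ℤ × Bool} :
    (shiftPerm (n + 1) ^ k) p ∈ Set.range (spread n t) ↔ p ∈ Set.range (spread n t) := by
  have key : ∀ (k : ℤ) (p), p ∈ Set.range (spread n t) →
      (shiftPerm (n + 1) ^ k) p ∈ Set.range (spread n t) := by
    rintro k _ ⟨q, rfl⟩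
    exact ⟨_, map_shiftPerm_zpow _ spread_shift k q⟩
  refine ⟨fun h => ?_, key k p⟩
  simpa [← Equiv.Perm.mul_apply] using key (-k) _ h

theorem shift_mem_range_spread {p : ℤ × Bool} :
    shift (n + 1) p ∈ Set.range (spread n t) ↔ p ∈ Set.range (spread n t) :=
  zpow_mem_range_spread (k := 1)

/-- The lifted marked points that are left out are the lifts of `t` and `t + 1`. -/
theorem not_mem_range_spread {p : ℤ × Bool} : p ∉ Set.range (spread n t) ↔
    ∃ k : ℤ, p = (shiftPerm (n + 1) ^ k) (t, false) ∨
      p = (shiftPerm (n + 1) ^ k) (t + 1, false) := by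
  constructor
  · have base : ∀ i : ℤ, (i, false) ∉ Set.range (spread n t) →
        ∃ k : ℤ, (i, false) = (shiftPerm (n + 1) ^ k) (t, false) ∨
          (i, false) = (shiftPerm (n + 1) ^ k) (t + 1, false) := by
      intro i hi
      have hN := two_mul_natCast_pos (n + 1)
      have hn := two_mul_natCast_pos n
      have h₁ := Int.emod_add_mul_ediv (i - t) (2 * (n + 1 : ℕ))
      have h₂ := Int.emod_nonneg (i - t) hN.ne'
      have h₃ := Int.emod_lt_of_pos (i - t) hN
      generalize (i - t) / (2 * (n + 1 : ℕ)) = k at *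
      generalize (i - t) % (2 * (n + 1 : ℕ)) = s at *
      refine ⟨2 * k, ?_⟩
      rw [shiftPerm_zpow_two_mul, shiftPerm_zpow_two_mul]
      simp only [Prod.mk.injEq, and_true]
      by_contra hc
      -- Here `s` is the offset from `t` in the `k`-th period, different from `0` and `1`; removing
      -- the two left-out points makes it `s - 2`.
      refine hi ⟨(2 * n * k + (s - 2), false), ?_⟩
      have hk : (2 * n * k + (s - 2)) / (2 * n : ℤ) = k := by
        rw [Int.add_comm, Int.add_mul_ediv_left _ _ hn.ne',
          Int.ediv_eq_zero_of_lt (by omega) (by push_cast at h₃; omega), zero_add]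
      simp only [spread, Bool.toNat_false, Nat.cast_zero, zero_mul, sub_zero, hk, Prod.mk.injEq,
        and_true]
      push_cast at h₁
      linarith
    intro hp
    obtain ⟨i, b⟩ := p
    cases b
    · exact base i hp
    · have e : ((i, true) : ℤ × Bool) = shift (n + 1) (i - (n + 1 : ℕ), false) := by simp [shift]
      rw [e, shift_mem_range_spread] at hp
      obtain ⟨k, hk⟩ := base _ hp
      refine ⟨1 + k, ?_⟩
      rw [e, zpow_add, Equiv.Perm.mul_apply, Equiv.Perm.mul_apply, zpow_one]
      simp only [shiftPerm_apply, (shift_injective (n + 1)).eq_iff]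
      exact hk
  · rintro ⟨k, rfl | rfl⟩ <;> rw [zpow_mem_range_spread]
    · rintro ⟨q, hq⟩; exact spread_ne_zero q hq
    · rintro ⟨q, hq⟩; exact spread_ne_one q hq

omit [NeZero n] in
theorem partner_shift (p : ℤ × Bool) :
    partner n t (shift (n + 1) p) = shift (n + 1) (partner n t p) := by
  obtain ⟨i, b⟩ := p
  have key : ((2 * (n + 1) : ℤ) ∣ i + (n + 1) - (!b).toNat * (n + 1) - t) ↔
      ((2 * (n + 1) : ℤ) ∣ i - b.toNat * (n + 1) - t) := by
    cases b
    · simp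
    · rw [← dvd_add_self_right (b := i - _ - t)]
      apply iff_of_eq
      congr 1
      simp only [Bool.not_true, Bool.toNat_false, Bool.toNat_true]
      push_cast
      ring
  simp only [partner, shift]
  push_cast
  rw [if_congr key rfl rfl]
  ext
  · simp only; split_ifs <;> ring
  · rfl

omit [NeZero n] in
theorem partner_zero : partner n t (t, false) = (t + 1, false) := by
  simp [partner]

omit [NeZero n] in
theorem partner_one : partner n t (t + 1, false) = (t, false) := by
  have : ¬ (2 * (n + 1) : ℤ) ∣ 1 := fun h => by
    have := Int.le_of_dvd one_pos h; omega
  simp [partner, this]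

omit [NeZero n] in
theorem partner_snd (p : ℤ × Bool) : (partner n t p).2 = p.2 := rfl

omit [NeZero n] in
theorem partner_ne (p : ℤ × Bool) : partner n t p ≠ p := by
  intro h
  have := congrArg Prod.fst h
  simp only [partner] at this
  split_ifs at this <;> omega

theorem partner_partner {p : ℤ × Bool} (hp : p ∉ Set.range (spread n t)) :
    partner n t (partner n t p) = p := by
  obtain ⟨k, rfl | rfl⟩ := not_mem_range_spread.1 hp <;>
    simp [map_shiftPerm_zpow _ partner_shift, partner_zero, partner_one]

theorem partner_not_mem {p : ℤ × Bool} (hp : p ∉ Set.range (spread n t)) :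
    partner n t p ∉ Set.range (spread n t) := by
  rw [not_mem_range_spread] at hp ⊢
  obtain ⟨k, rfl | rfl⟩ := hp <;> refine ⟨k, ?_⟩ <;>
    simp [map_shiftPerm_zpow _ partner_shift, partner_zero, partner_one]

omit [NeZero n] in
/-- No lifted marked point lies between a lift of `t` and the next lift of `t + 1`. -/
theorem precedes_partner {p q : ℤ × Bool} (h : q ≠ p) (h' : q ≠ partner n t p) :
    Precedes q p ↔ Precedes q (partner n t p) := by
  obtain ⟨i, b⟩ := p
  obtain ⟨j, c⟩ := q
  cases b <;> cases c <;> simp only [partner] at * <;> split_ifs at * <;>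
    simp only [Precedes, ne_eq, Prod.mk.injEq, and_true] at * <;> omega

omit [NeZero n] in
theorem precedes_partner' {p q : ℤ × Bool} (h : q ≠ p) (h' : q ≠ partner n t p) :
    Precedes p q ↔ Precedes (partner n t p) q := by
  obtain ⟨i, b⟩ := p
  obtain ⟨j, c⟩ := q
  cases b <;> cases c <;> simp only [partner] at * <;> split_ifs at * <;>
    simp only [Precedes, ne_eq, Prod.mk.injEq, and_true] at * <;> omega

/-! ### Inserting an arc -/

/-- The matching with an additional arc between `t` and `t + 1`. -/
noncomputable def cupMate (t : ℤ) (f : Diagram n) : ℤ × Bool → ℤ × Bool :=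
  Function.extend (spread n t) (fun p => spread n t (f.mate p)) (partner n t)

theorem cupMate_spread (f : Diagram n) (p : ℤ × Bool) :
    cupMate t f (spread n t p) = spread n t (f.mate p) :=
  spread_injective.extend_apply _ _ _

omit [NeZero n] in
theorem cupMate_of_not_mem (f : Diagram n) {p : ℤ × Bool} (hp : p ∉ Set.range (spread n t)) :
    cupMate t f p = partner n t p :=
  Function.extend_apply' _ _ _ hp

/-- The connection with an additional arc between `t` and `t + 1`. -/
noncomputable def insertCup (t : ℤ) (f : Diagram n) : Diagram (n + 1) :=
  Diagram.ofSameSide (cupMate t f)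
    (by
      intro p
      by_cases hp : p ∈ Set.range (spread n t)
      · obtain ⟨q, rfl⟩ := hp
        rw [cupMate_spread, cupMate_spread, f.mate_mate]
      · rw [cupMate_of_not_mem f hp, cupMate_of_not_mem f (partner_not_mem hp),
          partner_partner hp])
    (by
      intro p
      by_cases hp : p ∈ Set.range (spread n t)
      · obtain ⟨q, rfl⟩ := hp
        rw [cupMate_spread]
        exact fun h => f.mate_ne q (spread_injective h)
      · rw [cupMate_of_not_mem f hp]
        exact partner_ne p)
    (by
      intro p
      by_cases hp : p ∈ Set.range (spread n t)
      · obtain ⟨q, rfl⟩ := hp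
        rw [← spread_shift, cupMate_spread, cupMate_spread, f.mate_shift, spread_shift]
      · rw [cupMate_of_not_mem f hp, cupMate_of_not_mem f (shift_mem_range_spread.not.2 hp),
          partner_shift])
    (by
      intro p q h h'
      have hne : cupMate t f q ≠ p ∧ cupMate t f q ≠ cupMate t f p := by
        have inv : ∀ p, cupMate t f (cupMate t f p) = p := by
          intro p
          by_cases hp : p ∈ Set.range (spread n t)
          · obtain ⟨q, rfl⟩ := hp
            rw [cupMate_spread, cupMate_spread, f.mate_mate]
          · rw [cupMate_of_not_mem f hp, cupMate_of_not_mem f (partner_not_mem hp),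
              partner_partner hp]
        exact ⟨fun e => h' (by rw [← e, inv]), fun e => h (by rw [← inv q, e, inv])⟩
      by_cases hp : p ∈ Set.range (spread n t)
      · by_cases hq : q ∈ Set.range (spread n t)
        · obtain ⟨p, rfl⟩ := hp
          obtain ⟨q, rfl⟩ := hq
          rw [cupMate_spread] at h' ⊢
          rw [cupMate_spread]
          simp only [spread_precedes]
          exact f.same_side (fun e => h (e ▸ rfl)) (fun e => h' (e ▸ rfl))
        · rw [cupMate_of_not_mem f hq] at hne ⊢
          have e₁ := precedes_partner' (n := n) (t := t) (p := q) (q := p) h.symm hne.1.symm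
          have e₂ := precedes_partner' (n := n) (t := t) (p := q) h'.symm hne.2.symm
          rw [e₁, e₂]
      · rw [cupMate_of_not_mem f hp] at hne h' ⊢
        have e₁ := precedes_partner h h'
        have e₂ := precedes_partner hne.1 hne.2
        tauto)

theorem insertCup_mate_spread (f : Diagram n) (p : ℤ × Bool) :
    (insertCup t f).mate (spread n t p) = spread n t (f.mate p) :=
  cupMate_spread f p

theorem insertCup_mate_of_not_mem (f : Diagram n) {p : ℤ × Bool}
    (hp : p ∉ Set.range (spread n t)) : (insertCup t f).mate p = partner n t p :=
  cupMate_of_not_mem f hp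

theorem insertCup_mate_zero (f : Diagram n) :
    (insertCup t f).mate (t, false) = (t + 1, false) := by
  rw [insertCup_mate_of_not_mem f, partner_zero]
  rintro ⟨q, hq⟩
  exact spread_ne_zero q hq

theorem insertCup_injective : Function.Injective (insertCup t : Diagram n → Diagram (n + 1)) := by
  intro f g h
  ext1
  funext p
  apply spread_injective (n := n) (t := t)
  rw [← insertCup_mate_spread, ← insertCup_mate_spread, h]

/-- The marked point `t + 1` would be joined to both `t` and `t + 2`. -/
theorem insertCup_ne (f g : Diagram n) : insertCup t f ≠ insertCup (t + 1) g := by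
  intro h
  have h₁ := (insertCup t f).mate_mate (t, false)
  rw [insertCup_mate_zero, h, insertCup_mate_zero] at h₁
  simp at h₁
  omega

/-! ### Capping off -/

omit [NeZero n] in
-- Additivity of crossing parity: if two points are not separated by a chord from `a` to `b`, nor by
-- one from `b` to `c`, they are not separated by the chord from `a` to `c`.
theorem iff_iff_iff_trans {a b c a' b' c' : Prop} (h : (a ↔ b) ↔ (a' ↔ b'))
    (h' : (b ↔ c) ↔ (b' ↔ c')) : (a ↔ c) ↔ (a' ↔ c') := by
  tauto

/-- `g` with the marked points `t` and `t + 1` joined outside of the Möbius band is `h`, up to a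
closed curve. -/
def IsCap (t : ℤ) (g : Diagram (n + 1)) (h : Diagram n) : Prop :=
  ∀ p, spread n t (h.mate p) = g.mate (spread n t p) ∨
    (g.mate (spread n t p) ∉ Set.range (spread n t) ∧
      spread n t (h.mate p) = g.mate (partner n t (g.mate (spread n t p))))

/-- The marked points `t` and `t + 1` are joined to each other, or none of them to itself or to
the other. -/
theorem mate_left_out (t : ℤ) (g : Diagram (n + 1)) :
    (∀ p, p ∉ Set.range (spread n t) → g.mate p ∉ Set.range (spread n t)) ∨
      (∀ p, p ∉ Set.range (spread n t) → g.mate p ∈ Set.range (spread n t)) := by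
  by_cases H : ∃ k : ℤ, g.mate (t, false) = (shiftPerm (n + 1) ^ k) (t + 1, false)
  · left
    obtain ⟨k, hk⟩ := H
    have hk' : g.mate (t + 1, false) = (shiftPerm (n + 1) ^ (-k)) (t, false) := by
      rw [zpow_neg, Equiv.Perm.eq_inv_iff_eq, ← map_shiftPerm_zpow _ g.mate_shift, ← hk,
        g.mate_mate]
    intro p hp
    rw [not_mem_range_spread] at hp ⊢
    obtain ⟨l, rfl | rfl⟩ := hp
    · exact ⟨l + k, Or.inr (by
        rw [map_shiftPerm_zpow _ g.mate_shift, hk, zpow_add, Equiv.Perm.mul_apply])⟩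
    · exact ⟨l + -k, Or.inl (by
        rw [map_shiftPerm_zpow _ g.mate_shift, hk', zpow_add, Equiv.Perm.mul_apply])⟩
  · right
    -- No arc joins a marked point to itself: applying `mate` twice would translate a lift by `2k(n
    -- + 1)`, which forces `k = 0`.
    have self : ∀ (k : ℤ) (p), g.mate p ≠ (shiftPerm (n + 1) ^ k) p := by
      intro k p h
      have h₁ : g.mate (g.mate p) = (shiftPerm (n + 1) ^ (k + k)) p := by
        conv_lhs => rw [h, map_shiftPerm_zpow _ g.mate_shift, h]
        rw [zpow_add, Equiv.Perm.mul_apply]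
      rw [g.mate_mate] at h₁
      have h₂ := congrArg Prod.fst h₁
      rw [shiftPerm_zpow_fst] at h₂
      have h₃ : (k + k) * ((n + 1 : ℕ) : ℤ) = 0 := by linarith
      have h₄ : k = 0 := by
        rcases mul_eq_zero.1 h₃ with h | h
        · omega
        · push_cast at h; omega
      subst h₄
      exact g.mate_ne p h
    intro p hp
    by_contra hc
    rw [not_mem_range_spread] at hp hc
    obtain ⟨l, rfl | rfl⟩ := hp <;> obtain ⟨k, hk | hk⟩ := hc <;>
      rw [map_shiftPerm_zpow _ g.mate_shift, ← Equiv.Perm.eq_inv_iff_eq, ← zpow_neg,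
        ← Equiv.Perm.mul_apply, ← zpow_add] at hk
    · exact self _ _ hk
    · exact H ⟨_, hk⟩
    · refine H ⟨-(-l + k), ?_⟩
      rw [zpow_neg, Equiv.Perm.eq_inv_iff_eq, ← map_shiftPerm_zpow _ g.mate_shift, ← hk,
        g.mate_mate]
    · exact self _ _ hk

/-- One detour suffices: by `mate_left_out`, when an arc of `g` leads from a kept point to a
left-out one, the arc at its partner leads back to a kept point. -/
theorem exists_isCap (t : ℤ) (g : Diagram (n + 1)) : ∃ h : Diagram n, IsCap t g h := by
  have ex : ∀ p, ∃ q, spread n t q = g.mate (spread n t p) ∨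
      (g.mate (spread n t p) ∉ Set.range (spread n t) ∧
        spread n t q = g.mate (partner n t (g.mate (spread n t p)))) := by
    intro p
    by_cases hp : g.mate (spread n t p) ∈ Set.range (spread n t)
    · exact hp.imp fun q hq => Or.inl hq
    · rcases mate_left_out t g with H | H
      · exact absurd ⟨p, (g.mate_mate _).symm⟩ (H _ hp)
      · exact (H _ (partner_not_mem hp)).imp fun q hq => Or.inr ⟨hp, hq⟩
  choose μ hμ using ex
  have sep : ∀ {a b : ℤ × Bool}, a ∈ Set.range (spread n t) → b ∉ Set.range (spread n t) →
      a ≠ b := fun ha hb e => hb (e ▸ ha)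
  have mate_eq : ∀ {a b}, g.mate a = b → g.mate b = a := fun h => by rw [← h, g.mate_mate]
  have μμ : ∀ p, μ (μ p) = p := by
    intro p
    apply spread_injective (n := n) (t := t)
    rcases hμ p with h | ⟨h₁, h⟩ <;> rcases hμ (μ p) with h' | ⟨h₁', h'⟩
    · rw [h', h, g.mate_mate]
    · rw [h, g.mate_mate] at h₁'
      exact absurd ⟨p, rfl⟩ h₁'
    · rw [h, g.mate_mate] at h'
      exact absurd ⟨_, h'⟩ (partner_not_mem h₁)
    · rw [h', h, g.mate_mate, partner_partner h₁, g.mate_mate]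
  refine ⟨Diagram.ofSameSide μ μμ ?_ ?_ ?_, hμ⟩
  · intro p h
    rcases hμ p with h' | ⟨h₁, h'⟩
    · rw [h] at h'
      exact g.mate_ne _ h'.symm
    · rw [h] at h'
      have := g.mate_injective (h'.symm.trans (g.mate_mate _).symm)
      exact partner_ne _ this
  · intro p
    apply spread_injective (n := n) (t := t)
    rcases hμ p with h | ⟨h₁, h⟩ <;> rcases hμ (shift n p) with h' | ⟨h₁', h'⟩
    · rw [h', spread_shift, spread_shift, g.mate_shift, h]
    · rw [spread_shift, g.mate_shift, shift_mem_range_spread] at h₁'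
      exact absurd ⟨_, h⟩ h₁'
    · rw [spread_shift (n := n) p, g.mate_shift] at h'
      exact absurd ⟨_, h'⟩ (shift_mem_range_spread.not.2 h₁)
    · rw [h', spread_shift, g.mate_shift, partner_shift, g.mate_shift, ← h, spread_shift]
  · intro p q hqp hqp'
    have n₁ : spread n t q ≠ spread n t p := spread_injective.ne hqp
    have n₂ : spread n t q ≠ spread n t (μ p) := spread_injective.ne hqp'
    have n₃ : spread n t (μ q) ≠ spread n t p :=
      spread_injective.ne fun e => hqp' (by rw [← e, μμ])
    have n₄ : spread n t (μ q) ≠ spread n t (μ p) :=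
      spread_injective.ne fun e => hqp (by rw [← μμ q, e, μμ])
    rw [← spread_precedes (n := n) (t := t) q p, ← spread_precedes (n := n) (t := t) q (μ p),
      ← spread_precedes (n := n) (t := t) (μ q) p,
      ← spread_precedes (n := n) (t := t) (μ q) (μ p)]
    have hp : ∃ a, spread n t a = spread n t p := ⟨_, rfl⟩
    have hp' : ∃ a, spread n t a = spread n t (μ p) := ⟨_, rfl⟩
    have hq : ∃ a, spread n t a = spread n t q := ⟨_, rfl⟩
    have hq' : ∃ a, spread n t a = spread n t (μ q) := ⟨_, rfl⟩
    have P := hμ p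
    have Q := hμ q
    generalize spread n t p = a at n₁ n₃ hp P ⊢
    generalize spread n t (μ p) = b at n₂ n₄ hp' P ⊢
    generalize spread n t q = c at n₁ n₂ hq Q ⊢
    generalize spread n t (μ q) = d at n₃ n₄ hq' Q ⊢
    -- `c` and `d` lie on the same side of every chord of `g` with other endpoints
    have side : ∀ a, c ≠ a → c ≠ g.mate a → d ≠ a → d ≠ g.mate a →
        ((Precedes c a ↔ Precedes c (g.mate a)) ↔ (Precedes d a ↔ Precedes d (g.mate a))) := by
      intro a h₁ h₂ h₃ h₄
      rcases Q with rfl | ⟨hQ, rfl⟩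
      · exact g.same_side h₁ h₂
      · have m₁ : g.mate c ≠ a := fun e => h₂ (mate_eq e).symm
        have m₂ : g.mate c ≠ g.mate a := fun e => h₁ (g.mate_injective e)
        have m₃ : partner n t (g.mate c) ≠ a := fun e => h₄ (by rw [e])
        have m₄ : partner n t (g.mate c) ≠ g.mate a := fun e => h₃ (by rw [e, g.mate_mate])
        rw [g.same_side h₁ h₂, ← g.same_side m₃ m₄,
          precedes_partner' (n := n) (t := t) m₁.symm m₃.symm,
          precedes_partner' (n := n) (t := t) m₂.symm m₄.symm]
    -- A detour consists of two chords of `g` and a step between neighbours, which separates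
    -- nothing, so the parities along it add up.
    rcases P with rfl | ⟨hP, rfl⟩
    · exact side a n₁ n₂ n₃ n₄
    · have hP' := partner_not_mem hP
      have s₁ := side a n₁ (sep hq hP) n₃ (sep hq' hP)
      have s₂ := side (partner n t (g.mate a)) (sep hq hP') n₂ (sep hq' hP') n₄
      have s₃ := precedes_partner (n := n) (t := t) (sep hq hP) (sep hq hP')
      have s₄ := precedes_partner (n := n) (t := t) (sep hq' hP) (sep hq' hP')
      rw [s₃, s₄] at s₁
      exact iff_iff_iff_trans s₁ s₂

end spread

/-! ### The arcs in the universal cover of the Klein bottle -/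

/-- The parity of the height, which tells on which boundary line of a strip a lifted marked point
lies. -/
def onStrip (u : ℤ × ℤ) : ℤ × Bool := (u.1, decide (u.2 % 2 = 1))

/-- The other endpoint of the lifted arc of `f` in the strip above (`s = 1`) or below (`s = -1`)
the lines of even height. -/
def liftMate {n : ℕ} (s : ℤ) (f : Diagram n) (u : ℤ × ℤ) : ℤ × ℤ :=
  ((f.mate (onStrip u)).1, u.2 - s * (onStrip u).2.toNat + s * (f.mate (onStrip u)).2.toNat)

theorem liftMate_snd {n : ℕ} (s : ℤ) (f : Diagram n) (u : ℤ × ℤ) : (liftMate s f u).2 =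
    u.2 - s * (onStrip u).2.toNat + s * (f.mate (onStrip u)).2.toNat := rfl

theorem toNat_decide_odd (h : ℤ) : ((decide (h % 2 = 1)).toNat : ℤ) = h % 2 := by
  rcases Int.emod_two_eq_zero_or_one h with e | e <;> simp [e]

/-- The lifted curves thus become the orbits of two maps, both involutions by `liftMate_liftMate`.
-/
theorem joined_iff {n : ℕ} {f g : Diagram n} {u v : ℤ × ℤ} :
    Joined f g u v ↔ v = liftMate 1 f u ∨ v = liftMate (-1) g u := by
  constructor
  · rintro (⟨m, i, j, b, c, h⟩ | ⟨m, i, j, b, c, h⟩)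
    · left
      have : onStrip (i, 2 * m + b.toNat) = (i, b) := by
        cases b <;> simp [onStrip]
      simp [liftMate, this, h]
    · right
      have : onStrip (i, 2 * m - b.toNat) = (i, b) := by
        cases b <;> simp [onStrip]
      simp only [liftMate, this, h]
      congr 1
      ring
  · obtain ⟨i, k⟩ := u
    have := toNat_decide_odd k
    rintro (rfl | rfl)
    -- The strip of the first band at height `k` is `[2m, 2m + 1]` with `m = k / 2`; for the second
    -- band below it is `[2m - 1, 2m]` with `m = (k + 1) / 2`.
    · have J := Joined.first (f := f) (g := g) (k / 2) i (f.mate (i, decide (k % 2 = 1))).1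
        (decide (k % 2 = 1)) (f.mate (i, decide (k % 2 = 1))).2 rfl
      convert J using 2
      · omega
      · rfl
      · simp only [liftMate, onStrip]
        omega
    · have J := Joined.second (f := f) (g := g) ((k + 1) / 2) i (g.mate (i, decide (k % 2 = 1))).1
        (decide (k % 2 = 1)) (g.mate (i, decide (k % 2 = 1))).2 rfl
      convert J using 2
      · omega
      · rfl
      · simp only [liftMate, onStrip]
        omega

section lift

variable {n : ℕ} {s : ℤ}

/-- The height changes by `s` times the difference of the line indices; as `s` is odd, its parity
becomes that of the line of the mate. -/
theorem onStrip_liftMate (hs : Odd s) (f : Diagram n) (u : ℤ × ℤ) :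
    onStrip (liftMate s f u) = f.mate (onStrip u) := by
  obtain ⟨a, rfl⟩ := hs
  obtain ⟨i, k⟩ := u
  have := toNat_decide_odd k
  ext
  · rfl
  · suffices ∀ c : Bool, decide ((k - (2 * a + 1) * ((decide (k % 2 = 1)).toNat : ℤ) +
        (2 * a + 1) * c.toNat) % 2 = 1) = c from this _
    intro c
    rw [this]
    have key : (k - (2 * a + 1) * (k % 2) + (2 * a + 1) * c.toNat) % 2 = (c.toNat : ℤ) := by
      have : k - (2 * a + 1) * (k % 2) + (2 * a + 1) * c.toNat =
        c.toNat + 2 * (k / 2 + a * (c.toNat - k % 2)) := by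
        linear_combination -Int.emod_add_mul_ediv k 2
      rw [this, Int.add_mul_emod_self_left]
      cases c <;> rfl
    rw [key]
    cases c <;> simp

theorem liftMate_liftMate (hs : Odd s) (f : Diagram n) (u : ℤ × ℤ) :
    liftMate s f (liftMate s f u) = u := by
  have h := onStrip_liftMate hs f u
  unfold liftMate at h ⊢
  rw [h, f.mate_mate]
  ext
  · rfl
  · simp only; ring

/-- The deck transformations commute with the arcs. -/
structure IsDeck (n : ℕ) (γ : ℤ × ℤ → ℤ × ℤ) : Prop where
  liftMate_comm : ∀ (s : ℤ) (f : Diagram n) u, liftMate s f (γ u) = γ (liftMate s f u)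

theorem onStrip_reflect (n : ℕ) {c : ℤ} (hc : Odd c) (u : ℤ × ℤ) :
    onStrip (u.1 + n, c - u.2) = shift n (onStrip u) := by
  obtain ⟨a, rfl⟩ := hc
  simp only [onStrip, shift, Prod.mk.injEq, true_and]
  rw [← decide_not]
  exact decide_eq_decide.2 (by omega)

/-- Treats `deck₁` (`c = 1`) and `deck₂` (`c = -1`) at once. -/
theorem isDeck_reflect (n : ℕ) {c : ℤ} (hc : Odd c) : IsDeck n fun u => (u.1 + n, c - u.2) := by
  refine ⟨fun s f u => ?_⟩
  simp only [liftMate, onStrip_reflect n hc, f.mate_shift]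
  generalize onStrip u = p
  generalize f.mate p = q
  obtain ⟨i, b⟩ := p
  obtain ⟨j, e⟩ := q
  ext
  · rfl
  · cases b <;> cases e <;> simp [shift] <;> ring

theorem isDeck₁ (n : ℕ) : IsDeck n (deck₁ n) := isDeck_reflect n odd_one

theorem isDeck₂ (n : ℕ) : IsDeck n (deck₂ n) := isDeck_reflect n (by decide)

theorem isDeck_up (n : ℕ) : IsDeck n fun u => (u.1, u.2 + 2) := by
  refine ⟨fun s f u => ?_⟩
  have : onStrip (u.1, u.2 + 2) = onStrip u := by simp [onStrip]
  simp only [liftMate, this]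
  ext
  · rfl
  · simp only; ring

theorem IsDeck.comp {γ δ : ℤ × ℤ → ℤ × ℤ} (h : IsDeck n γ) (h' : IsDeck n δ) :
    IsDeck n (γ ∘ δ) :=
  ⟨fun s f u => by simp [h.liftMate_comm, h'.liftMate_comm]⟩

theorem deck₁_comp_deck₁ (n : ℕ) :
    deck₁ n ∘ deck₁ n = fun u : ℤ × ℤ => (u.1 + 2 * n, u.2) := by
  funext u
  simp [deck₁]; ring

theorem isDeck_right (n : ℕ) : IsDeck n fun u => (u.1 + 2 * n, u.2) :=
  deck₁_comp_deck₁ n ▸ (isDeck₁ n).comp (isDeck₁ n)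

theorem IsDeck.joined {γ : ℤ × ℤ → ℤ × ℤ} (h : IsDeck n γ) {f g : Diagram n} {u v : ℤ × ℤ}
    (H : Joined f g u v) : Joined f g (γ u) (γ v) := by
  rw [joined_iff] at H ⊢
  rw [h.liftMate_comm, h.liftMate_comm]
  exact H.imp (congrArg γ) (congrArg γ)

end lift

/-! ### Equivalences generated by relations -/

theorem eqvGen_map {V W : Type*} {r : V → V → Prop} {s : W → W → Prop} (φ : V → W)
    (h : ∀ u v, r u v → Relation.EqvGen s (φ u) (φ v)) {u v : V} (H : Relation.EqvGen r u v) :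
    Relation.EqvGen s (φ u) (φ v) := by
  induction H with
  | rel u v H => exact h u v H
  | refl u => exact .refl _
  | symm u v _ ih => exact .symm _ _ ih
  | trans u v w _ _ ih ih' => exact .trans _ _ _ ih ih'

/-- A simulation argument: matching each generating step in both directions suffices, the second
direction serving symmetry. The correspondence `ρ` is a relation since points of a curve that is cut
off correspond to nothing. -/
theorem eqvGen_transfer {V W : Type*} {r : V → V → Prop} {T : W → W → Prop} (hT : Equivalence T)
    (ρ : V → W → Prop) (h : ∀ u v, r u v → ∀ a, ρ u a → ∃ b, ρ v b ∧ T a b)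
    (h' : ∀ u v, r u v → ∀ b, ρ v b → ∃ a, ρ u a ∧ T a b) {u v : V}
    (H : Relation.EqvGen r u v) : ∀ a, ρ u a → ∃ b, ρ v b ∧ T a b := by
  suffices (∀ a, ρ u a → ∃ b, ρ v b ∧ T a b) ∧ (∀ b, ρ v b → ∃ a, ρ u a ∧ T a b) from this.1
  induction H with
  | rel u v H => exact ⟨h u v H, h' u v H⟩
  | refl u => exact ⟨fun a ha => ⟨a, ha, hT.refl a⟩, fun a ha => ⟨a, ha, hT.refl a⟩⟩
  | symm u v _ ih =>
    refine ⟨fun a ha => ?_, fun a ha => ?_⟩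
    · obtain ⟨b, hb, hab⟩ := ih.2 a ha
      exact ⟨b, hb, hT.symm hab⟩
    · obtain ⟨b, hb, hab⟩ := ih.1 a ha
      exact ⟨b, hb, hT.symm hab⟩
  | trans u v w _ _ ih ih' =>
    refine ⟨fun a ha => ?_, fun a ha => ?_⟩
    · obtain ⟨b, hb, hab⟩ := ih.1 a ha
      obtain ⟨c, hc, hbc⟩ := ih'.1 b hb
      exact ⟨c, hc, hT.trans hab hbc⟩
    · obtain ⟨b, hb, hab⟩ := ih'.2 a ha
      obtain ⟨c, hc, hbc⟩ := ih.2 b hb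
      exact ⟨c, hc, hT.trans hbc hab⟩

/-! ### Inserting an arc and capping off in the universal cover -/

/-- The embedding of the lifted marked points that leaves out the marked points `t` and
`t + 1`. -/
def spreadLift (n : ℕ) (t : ℤ) (u : ℤ × ℤ) : ℤ × ℤ := ((spread n t (onStrip u)).1, u.2)

section cap

variable {n : ℕ} {t : ℤ}

theorem onStrip_spreadLift (u : ℤ × ℤ) :
    onStrip (spreadLift n t u) = spread n t (onStrip u) := rfl

theorem mem_range_spreadLift {u : ℤ × ℤ} :
    u ∈ Set.range (spreadLift n t) ↔ onStrip u ∈ Set.range (spread n t) := by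
  constructor
  · rintro ⟨v, rfl⟩
    exact ⟨_, rfl⟩
  · rintro ⟨p, hp⟩
    have h₂ : p.2 = (onStrip u).2 := by rw [← hp]; rfl
    have h₁ : onStrip (p.1, u.2) = p := by ext <;> simp [onStrip, h₂]
    refine ⟨(p.1, u.2), ?_⟩
    ext
    · simp only [spreadLift, h₁, hp]; rfl
    · rfl

theorem liftMate_spreadLift {s : ℤ} {f : Diagram n} {F : Diagram (n + 1)} {u : ℤ × ℤ}
    (h : F.mate (spread n t (onStrip u)) = spread n t (f.mate (onStrip u))) (hs : Odd s) :
    liftMate s F (spreadLift n t u) = spreadLift n t (liftMate s f u) := by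
  ext
  · simp only [spreadLift, onStrip_liftMate hs]
    rw [← h]
    rfl
  · change u.2 - s * (spread n t (onStrip u)).2.toNat +
      s * (F.mate (spread n t (onStrip u))).2.toNat = _
    rw [h]
    rfl

theorem spreadLift_reflect [NeZero n] {c : ℤ} (hc : Odd c) (u : ℤ × ℤ) :
    spreadLift n t (u.1 + n, c - u.2) =
      ((spreadLift n t u).1 + (n + 1 : ℕ), c - (spreadLift n t u).2) := by
  simp only [spreadLift, onStrip_reflect n hc, spread_shift]
  rfl

/-- Deck transformations before and after the insertion of two marked points. -/
structure Corresponds (n : ℕ) (t : ℤ) (γ δ : ℤ × ℤ → ℤ × ℤ) : Prop where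
  spreadLift_comm : ∀ u, spreadLift n t (γ u) = δ (spreadLift n t u)
  isDeck : IsDeck n γ
  isDeck' : IsDeck (n + 1) δ

theorem corresponds₁ [NeZero n] : Corresponds n t (deck₁ n) (deck₁ (n + 1)) :=
  ⟨spreadLift_reflect odd_one, isDeck₁ _, isDeck₁ _⟩

theorem corresponds₂ [NeZero n] : Corresponds n t (deck₂ n) (deck₂ (n + 1)) :=
  ⟨spreadLift_reflect (by decide), isDeck₂ _, isDeck₂ _⟩

theorem corresponds_up : Corresponds n t (fun u => (u.1, u.2 + 2)) (fun u => (u.1, u.2 + 2)) :=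
  ⟨fun u => by simp [spreadLift, onStrip], isDeck_up _, isDeck_up _⟩

theorem corresponds_right [NeZero n] : Corresponds n t (fun u => (u.1 + 2 * n, u.2))
    (fun u => (u.1 + 2 * (n + 1 : ℕ), u.2)) := by
  refine ⟨fun u => ?_, isDeck_right _, isDeck_right _⟩
  rw [← congrFun (deck₁_comp_deck₁ n) u, Function.comp_apply, corresponds₁.spreadLift_comm,
    corresponds₁.spreadLift_comm]
  exact congrFun (deck₁_comp_deck₁ (n + 1)) _

variable [NeZero n]

theorem spreadLift_injective : Function.Injective (spreadLift n t) := by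
  intro u v h
  have h₁ : onStrip u = onStrip v := spread_injective (n := n) (t := t) (by
    rw [← onStrip_spreadLift, ← onStrip_spreadLift, h])
  ext
  · exact (congrArg Prod.fst h₁ :)
  · exact (congrArg Prod.snd h :)

variable {f : Diagram n} {g : Diagram (n + 1)} {h : Diagram n}

theorem liftMate_insertCup (u : ℤ × ℤ) :
    liftMate 1 (insertCup t f) (spreadLift n t u) = spreadLift n t (liftMate 1 f u) :=
  liftMate_spreadLift (insertCup_mate_spread f _) odd_one

/-- The exchange of the lifts of `t` and `t + 1`. -/
def partnerLift (n : ℕ) (t : ℤ) (u : ℤ × ℤ) : ℤ × ℤ := ((partner n t (onStrip u)).1, u.2)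

omit [NeZero n] in
theorem onStrip_partnerLift (u : ℤ × ℤ) :
    onStrip (partnerLift n t u) = partner n t (onStrip u) := rfl

theorem liftMate_insertCup' {u : ℤ × ℤ} (hu : u ∉ Set.range (spreadLift n t)) :
    liftMate 1 (insertCup t f) u = partnerLift n t u := by
  rw [mem_range_spreadLift] at hu
  simp only [liftMate, insertCup_mate_of_not_mem f hu, partnerLift, partner_snd]
  ext
  · rfl
  · simp only; ring

theorem partnerLift_not_mem {u : ℤ × ℤ} (hu : u ∉ Set.range (spreadLift n t)) :
    partnerLift n t u ∉ Set.range (spreadLift n t) := by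
  rw [mem_range_spreadLift] at hu ⊢
  exact partner_not_mem hu

theorem odd_neg_one : Odd (-1 : ℤ) := by decide

omit [NeZero n] in
-- The step to the partner keeps the height, so the height changes along a detour telescope to that
-- of the single arc of `h`.
theorem IsCap.liftMate (hc : IsCap t g h) (u : ℤ × ℤ) :
    spreadLift n t (liftMate (-1) h u) = liftMate (-1) g (spreadLift n t u) ∨
      (MobiusGram.liftMate (-1) g (spreadLift n t u) ∉ Set.range (spreadLift n t) ∧
        spreadLift n t (MobiusGram.liftMate (-1) h u) = MobiusGram.liftMate (-1) g
          (partnerLift n t (MobiusGram.liftMate (-1) g (spreadLift n t u)))) := by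
  rcases hc (onStrip u) with H | ⟨H₁, H⟩
  · left
    rw [liftMate_spreadLift H.symm odd_neg_one]
  · right
    have e := onStrip_liftMate odd_neg_one g (spreadLift n t u)
    rw [onStrip_spreadLift] at e
    refine ⟨by rwa [mem_range_spreadLift, e], ?_⟩
    have e' : onStrip (partnerLift n t (MobiusGram.liftMate (-1) g (spreadLift n t u))) =
        partner n t (g.mate (spread n t (onStrip u))) := by rw [onStrip_partnerLift, e]
    ext
    · change (spread n t (onStrip (MobiusGram.liftMate (-1) h u))).1 = (g.mate (onStrip _)).1
      rw [e', ← H, onStrip_liftMate odd_neg_one]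
    · change u.2 - _ + -1 * (spread n t (h.mate (onStrip u))).2.toNat = _
      rw [H]
      rw [liftMate_snd _ _ (partnerLift n t _), e', partner_snd]
      change _ = (MobiusGram.liftMate (-1) g (spreadLift n t u)).2 - _ + _
      rw [liftMate_snd]
      simp only [onStrip_spreadLift]
      simp only [spread, spreadLift]
      ring

/-! ### The curves before and after capping off -/

theorem sameLift_first {n : ℕ} (f g : Diagram n) (u : ℤ × ℤ) :
    SameLift f g u (liftMate 1 f u) := .rel _ _ (joined_iff.2 (Or.inl rfl))

theorem sameLift_second {n : ℕ} (f g : Diagram n) (u : ℤ × ℤ) :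
    SameLift f g u (liftMate (-1) g u) := .rel _ _ (joined_iff.2 (Or.inr rfl))

theorem SameLift.sameCurve {n : ℕ} {f g : Diagram n} {u v : ℤ × ℤ} (H : SameLift f g u v) :
    sameCurve f g u v :=
  eqvGen_map (fun u => u) (fun _ _ h => .rel _ _ (Or.inl h)) H

theorem sameCurve_deck₁ {n : ℕ} (f g : Diagram n) (u : ℤ × ℤ) :
    sameCurve f g u (deck₁ n u) := .rel _ _ (Or.inr (Or.inl rfl))

theorem sameCurve_deck₂ {n : ℕ} (f g : Diagram n) (u : ℤ × ℤ) :
    sameCurve f g u (deck₂ n u) := .rel _ _ (Or.inr (Or.inr rfl))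

/-- A detour is realised by an arc of `g`, the inserted arc and another arc of `g`. -/
theorem IsCap.joined_spreadLift (hc : IsCap t g h) {u v : ℤ × ℤ} (H : Joined f h u v) :
    SameLift (insertCup t f) g (spreadLift n t u) (spreadLift n t v) := by
  rcases joined_iff.1 H with rfl | rfl
  · rw [← liftMate_insertCup]
    exact sameLift_first _ _ _
  · rcases hc.liftMate u with e | ⟨e₁, e⟩
    · rw [e]
      exact sameLift_second _ _ _
    · rw [e]
      refine .trans _ _ _ (sameLift_second _ _ _) (.trans _ _ _ ?_ (sameLift_second _ _ _))
      rw [← liftMate_insertCup' (f := f) e₁]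
      exact sameLift_first _ _ _

theorem IsCap.sameLift_spreadLift (hc : IsCap t g h) {u v : ℤ × ℤ} (H : SameLift f h u v) :
    SameLift (insertCup t f) g (spreadLift n t u) (spreadLift n t v) :=
  eqvGen_map (spreadLift n t) (fun _ _ H => hc.joined_spreadLift H) H

theorem IsCap.sameCurve_spreadLift (hc : IsCap t g h) {u v : ℤ × ℤ} (H : sameCurve f h u v) :
    sameCurve (insertCup t f) g (spreadLift n t u) (spreadLift n t v) := by
  refine eqvGen_map (spreadLift n t) ?_ H
  rintro u v (H | rfl | rfl)
  · exact (hc.joined_spreadLift H).sameCurve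
  · rw [corresponds₁.spreadLift_comm]; exact sameCurve_deck₁ _ _ _
  · rw [corresponds₂.spreadLift_comm]; exact sameCurve_deck₂ _ _ _

/-- The lifted marked point `a` is, after insertion of the marked points that were left out, the
next one on the curve of `u`. -/
def Retracts (t : ℤ) (g : Diagram (n + 1)) (u a : ℤ × ℤ) : Prop :=
  u = spreadLift n t a ∨
    (u ∉ Set.range (spreadLift n t) ∧ MobiusGram.liftMate (-1) g u = spreadLift n t a)

theorem retracts_spreadLift {a b : ℤ × ℤ} : Retracts t g (spreadLift n t a) b ↔ a = b := by
  constructor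
  · rintro (H | ⟨H, -⟩)
    · exact spreadLift_injective H
    · exact absurd ⟨_, rfl⟩ H
  · rintro rfl
    exact Or.inl rfl

omit [NeZero n] in
theorem Retracts.sameLift {F : Diagram (n + 1)} {u a : ℤ × ℤ} (H : Retracts t g u a) :
    SameLift F g u (spreadLift n t a) := by
  rcases H with rfl | ⟨-, H⟩
  · exact .refl _
  · rw [← H]
    exact sameLift_second _ _ _

theorem Joined.symm {n : ℕ} {f g : Diagram n} {u v : ℤ × ℤ} (H : Joined f g u v) :
    Joined f g v u := by
  rw [joined_iff] at H ⊢
  rcases H with rfl | rfl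
  · exact Or.inl (liftMate_liftMate odd_one _ _).symm
  · exact Or.inr (liftMate_liftMate odd_neg_one _ _).symm

/-- A left-out point retracts to the kept end of its arc of `g`. Along a detour only the inserted
arc therefore moves the retraction, by one arc of `h`. -/
theorem IsCap.retracts_joined (hc : IsCap t g h) {u v a : ℤ × ℤ}
    (H : Joined (insertCup t f) g u v) (ha : Retracts t g u a) :
    ∃ b, Retracts t g v b ∧ SameLift f h a b := by
  have inv := liftMate_liftMate odd_neg_one g
  rcases joined_iff.1 H with rfl | rfl <;> rcases ha with rfl | ⟨hu, ha⟩
  · rw [liftMate_insertCup]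
    exact ⟨_, Or.inl rfl, sameLift_first _ _ _⟩
  · have hu' := partnerLift_not_mem hu
    rw [liftMate_insertCup' hu]
    refine ⟨_, Or.inr ⟨hu', ?_⟩, sameLift_second f h a⟩
    rcases hc.liftMate a with e | ⟨-, e⟩
    · rw [← ha, inv] at e
      exact absurd ⟨_, e⟩ hu
    · rw [e, ← ha, inv]
  · rcases hc.liftMate a with e | ⟨e₁, -⟩
    · exact ⟨_, Or.inl e.symm, sameLift_second _ _ _⟩
    · exact ⟨a, Or.inr ⟨e₁, inv _⟩, .refl _⟩
  · exact ⟨a, Or.inl ha, .refl _⟩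

theorem IsCap.retracts_sameLift (hc : IsCap t g h) {u v a : ℤ × ℤ}
    (H : SameLift (insertCup t f) g u v) (ha : Retracts t g u a) :
    ∃ b, Retracts t g v b ∧ SameLift f h a b :=
  eqvGen_transfer (Relation.EqvGen.is_equivalence _) (Retracts t g)
    (fun _ _ H _ ha => hc.retracts_joined H ha)
    (fun _ _ H _ hb => (hc.retracts_joined H.symm hb).imp fun _ h => ⟨h.1, .symm _ _ h.2⟩) H a ha

theorem retracts_reflect {c : ℤ} (hcodd : Odd c) {u a : ℤ × ℤ} (ha : Retracts t g u a) :
    Retracts t g (u.1 + (n + 1 : ℕ), c - u.2) (a.1 + n, c - a.2) := by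
  rcases ha with rfl | ⟨hu, ha⟩
  · exact Or.inl (spreadLift_reflect hcodd a).symm
  · refine Or.inr ⟨?_, ?_⟩
    · rwa [mem_range_spreadLift, onStrip_reflect _ hcodd, shift_mem_range_spread,
        ← mem_range_spreadLift]
    · rw [(isDeck_reflect (n + 1) hcodd).liftMate_comm, ha, spreadLift_reflect hcodd]

theorem retracts_reflect_iff {c : ℤ} (hcodd : Odd c) {u b : ℤ × ℤ}
    (hb : Retracts t g (u.1 + (n + 1 : ℕ), c - u.2) b) :
    ∃ a, Retracts t g u a ∧ (a.1 + n, c - a.2) = b := by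
  have surj : ((b.1 - n) + n, c - (c - b.2)) = b := by ext <;> simp
  refine ⟨(b.1 - n, c - b.2), ?_, surj⟩
  have inj : Function.Injective fun u : ℤ × ℤ => (u.1 + (n + 1 : ℕ), c - u.2) := by
    intro u v h
    simp only [Prod.mk.injEq] at h
    ext
    · omega
    · omega
  have e := spreadLift_reflect (n := n) (t := t) hcodd (b.1 - n, c - b.2)
  simp only [surj] at e
  rcases hb with H | ⟨hu, H⟩
  · exact Or.inl (inj (H.trans e))
  · refine Or.inr ⟨?_, ?_⟩
    · rwa [mem_range_spreadLift, onStrip_reflect _ hcodd, shift_mem_range_spread,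
        ← mem_range_spreadLift] at hu
    · rw [(isDeck_reflect (n + 1) hcodd).liftMate_comm] at H
      exact inj (H.trans e)

theorem IsCap.retracts_sameCurve (hc : IsCap t g h) {u v a : ℤ × ℤ}
    (H : sameCurve (insertCup t f) g u v) (ha : Retracts t g u a) :
    ∃ b, Retracts t g v b ∧ sameCurve f h a b := by
  refine eqvGen_transfer (sameCurve f h).iseqv (Retracts t g) ?_ ?_ H a ha
  · rintro u v (H | rfl | rfl) a ha
    · exact (hc.retracts_joined H ha).imp fun _ h => ⟨h.1, h.2.sameCurve⟩
    · exact ⟨_, retracts_reflect odd_one ha, sameCurve_deck₁ _ _ _⟩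
    · exact ⟨_, retracts_reflect odd_neg_one ha, sameCurve_deck₂ _ _ _⟩
  · rintro u v (H | rfl | rfl) b hb
    · exact (hc.retracts_joined H.symm hb).imp fun _ h => ⟨h.1, h.2.sameCurve.symm⟩
    · obtain ⟨a, ha, rfl⟩ := retracts_reflect_iff odd_one hb
      exact ⟨a, ha, sameCurve_deck₁ _ _ _⟩
    · obtain ⟨a, ha, rfl⟩ := retracts_reflect_iff odd_neg_one hb
      exact ⟨a, ha, sameCurve_deck₂ _ _ _⟩

/-- The curves of the capped connection among those of the original one. -/
noncomputable def IsCap.curveMap (hc : IsCap t g h) (f : Diagram n) :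
    Curve f h → Curve (insertCup t f) g :=
  Quotient.map (spreadLift n t) fun _ _ => hc.sameCurve_spreadLift

theorem IsCap.curveMap_injective (hc : IsCap t g h) (f : Diagram n) :
    Function.Injective (hc.curveMap f) := by
  intro c c'
  refine Quotient.inductionOn₂ c c' fun a b H => ?_
  have H' := Quotient.exact H
  obtain ⟨b', hb', hab⟩ := hc.retracts_sameCurve H' (Or.inl rfl)
  rw [retracts_spreadLift.1 hb']
  exact Quotient.sound hab

theorem SameLift.deck {n : ℕ} {f g : Diagram n} {γ : ℤ × ℤ → ℤ × ℤ} (hγ : IsDeck n γ)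
    {u v : ℤ × ℤ} (H : SameLift f g u v) : SameLift f g (γ u) (γ v) :=
  eqvGen_map γ (fun _ _ h => .rel _ _ (hγ.joined h)) H

/-- An invariant lift contains a kept point `b` and its image `δ b`, also kept; retracting the path
between them gives an invariant lift of the capped curve. -/
theorem IsCap.curveMap_invariant (hc : IsCap t g h) {γ δ : ℤ × ℤ → ℤ × ℤ}
    (hγ : Corresponds n t γ δ) (c : Curve f h) :
    (hc.curveMap f c).Invariant δ ↔ c.Invariant γ := by
  constructor
  · rintro ⟨u, hu, H⟩
    obtain ⟨a, rfl⟩ := Quotient.exists_rep c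
    obtain ⟨b, hb, hab⟩ := hc.retracts_sameCurve (Quotient.exact hu.symm) (Or.inl rfl)
    refine ⟨b, Quotient.sound hab.symm, ?_⟩
    have hbu := hb.sameLift (F := insertCup t f)
    have H' : SameLift (insertCup t f) g (spreadLift n t b) (spreadLift n t (γ b)) := by
      rw [hγ.spreadLift_comm]
      exact .trans _ _ _ (.symm _ _ hbu) (.trans _ _ _ H (hbu.deck hγ.isDeck'))
    obtain ⟨e, he, hbe⟩ := hc.retracts_sameLift H' (Or.inl rfl)
    rwa [retracts_spreadLift.1 he]
  · rintro ⟨u, rfl, H⟩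
    refine ⟨spreadLift n t u, rfl, ?_⟩
    rw [← hγ.spreadLift_comm]
    exact hc.sameLift_spreadLift H

theorem IsCap.curveMap_weight {R : Type*} (d w x y z : R) (hc : IsCap t g h) (c : Curve f h) :
    (hc.curveMap f c).weight d w x y z = c.weight d w x y z := by
  classical
  exact if_congr (hc.curveMap_invariant corresponds₁ c) rfl <|
    if_congr (hc.curveMap_invariant corresponds₂ c) rfl <|
    if_congr (hc.curveMap_invariant corresponds_up c) rfl <|
    if_congr (hc.curveMap_invariant corresponds_right c) rfl rfl

/-- If the marked points `t` and `t + 1` are not joined to each other, capping off preserves the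
form. -/
theorem IsCap.form_eq {R : Type*} [CommRing R] (d w x y z : R) (hc : IsCap t g h)
    (hg : ∀ p, p ∉ Set.range (spread n t) → g.mate p ∈ Set.range (spread n t)) :
    form d w x y z (insertCup t f) g = form d w x y z f h := by
  refine (Fintype.prod_bijective (hc.curveMap f) ⟨hc.curveMap_injective f, ?_⟩ _ _
    fun c => (hc.curveMap_weight d w x y z c).symm).symm
  intro c
  obtain ⟨u, rfl⟩ := Quotient.exists_rep c
  suffices ∃ a, Retracts t g u a by
    obtain ⟨a, ha⟩ := this
    exact ⟨Quotient.mk _ a, Quotient.sound (ha.sameLift.sameCurve).symm⟩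
  by_cases hu : u ∈ Set.range (spreadLift n t)
  · obtain ⟨a, rfl⟩ := hu
    exact ⟨a, Or.inl rfl⟩
  · have : MobiusGram.liftMate (-1) g u ∈ Set.range (spreadLift n t) := by
      rw [mem_range_spreadLift, onStrip_liftMate odd_neg_one]
      exact hg _ (mem_range_spreadLift.not.1 hu)
    obtain ⟨a, ha⟩ := this
    exact ⟨a, Or.inr ⟨hu, ha.symm⟩⟩

/-! ### The curve that is cut off -/

section closed

variable (hg : ∀ p, p ∉ Set.range (spread n t) → g.mate p ∉ Set.range (spread n t))
include hg

theorem joined_not_mem {u v : ℤ × ℤ} (H : Joined (insertCup t f) g u v)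
    (hu : u ∉ Set.range (spreadLift n t)) : v ∉ Set.range (spreadLift n t) := by
  rcases joined_iff.1 H with rfl | rfl
  · rw [liftMate_insertCup' hu]
    exact partnerLift_not_mem hu
  · rw [mem_range_spreadLift, onStrip_liftMate odd_neg_one]
    exact hg _ (mem_range_spreadLift.not.1 hu)

omit [NeZero n] in
theorem not_retracts {u a : ℤ × ℤ} (hu : u ∉ Set.range (spreadLift n t)) :
    ¬ Retracts t g u a := by
  rintro (rfl | ⟨-, H⟩)
  · exact hu ⟨_, rfl⟩
  · refine hg _ (mem_range_spreadLift.not.1 hu) ?_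
    rw [← onStrip_liftMate odd_neg_one, H]
    exact ⟨_, rfl⟩

/-- The lifts of the curve that is cut off do not depend on the other arcs. -/
theorem sameLift_insertCup (f f' : Diagram n) {u v : ℤ × ℤ}
    (hu : u ∉ Set.range (spreadLift n t)) (H : SameLift (insertCup t f) g u v) :
    SameLift (insertCup t f') g u v := by
  have base : ∀ u v, Joined (insertCup t f) g u v → u ∉ Set.range (spreadLift n t) →
      v ∉ Set.range (spreadLift n t) ∧ Joined (insertCup t f') g u v := by
    intro u v H hu
    refine ⟨joined_not_mem hg H hu, ?_⟩
    rw [joined_iff, liftMate_insertCup' hu] at H ⊢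
    exact H
  have key := eqvGen_transfer (r := Joined (insertCup t f) g)
    (T := SameLift (insertCup t f') g) (Relation.EqvGen.is_equivalence _)
    (fun u a => u = a ∧ u ∉ Set.range (spreadLift n t))
    (by
      rintro u v H _ ⟨rfl, hu⟩
      have := base u v H hu
      exact ⟨v, ⟨rfl, this.1⟩, .rel _ _ this.2⟩)
    (by
      rintro u v H _ ⟨rfl, hv⟩
      have := base v u H.symm hv
      exact ⟨u, ⟨rfl, this.1⟩, .rel _ _ this.2.symm⟩) H
  obtain ⟨b, ⟨rfl, -⟩, hb⟩ := key u ⟨rfl, hu⟩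
  exact hb

/-- A kept point retracts to itself, hence so does everything on its curve to something; under `hg`
a left-out point has no retraction. -/
theorem sameCurve_not_mem {u v : ℤ × ℤ} (H : sameCurve (insertCup t f) g u v)
    (hu : u ∉ Set.range (spreadLift n t)) : v ∉ Set.range (spreadLift n t) := by
  rintro ⟨a, rfl⟩
  obtain ⟨h, hc⟩ := exists_isCap t g
  obtain ⟨b, hb, -⟩ := hc.retracts_sameCurve H.symm (Or.inl rfl)
  exact not_retracts hg hu hb

omit hg [NeZero n] in
-- `deck₁` and `deck₂` together change the height by two, so only its parity matters; on what
-- remains `deck₁` acts as `shift`.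
theorem sameCurve_of_onStrip {n : ℕ} (f g : Diagram n) {k : ℤ} {u v : ℤ × ℤ}
    (H : onStrip u = (shiftPerm n ^ k) (onStrip v)) : sameCurve f g u v := by
  have up : ∀ i h : ℤ, sameCurve f g (i, h) (i, h + 2) := by
    intro i h
    have e₁ : deck₁ n (i - n, -1 - h) = (i, h + 2) := by simp [deck₁]; ring
    have e₂ : deck₂ n (i - n, -1 - h) = (i, h) := by simp [deck₂]
    rw [← e₁, ← e₂]
    exact .trans _ _ _ (.symm _ _ (sameCurve_deck₂ _ _ _)) (sameCurve_deck₁ _ _ _)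
  have up' : ∀ i h k : ℤ, sameCurve f g (i, h) (i, h + 2 * k) := by
    intro i h k
    induction k using Int.induction_on with
    | zero => simp
    | succ k ih =>
      have e := up i (h + 2 * k)
      rw [show h + 2 * (k : ℤ) + 2 = h + 2 * (k + 1) by ring] at e
      exact .trans _ _ _ ih e
    | pred k ih =>
      have e := up i (h + 2 * (-k - 1))
      rw [show h + 2 * (-(k : ℤ) - 1) + 2 = h + 2 * -k by ring] at e
      exact .trans _ _ _ ih (.symm _ _ e)
  induction k using Int.induction_on generalizing v with
  | zero =>
    obtain ⟨i, h⟩ := u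
    obtain ⟨j, h'⟩ := v
    simp only [zpow_zero, Equiv.Perm.one_apply, onStrip, Prod.mk.injEq, decide_eq_decide] at H
    obtain ⟨rfl, H⟩ := H
    have e : h' = h + 2 * ((h' - h) / 2) := by omega
    rw [e]
    exact up' i h _
  | succ k ih =>
    refine .trans _ _ _ (ih (v := deck₁ n v) ?_) (.symm _ _ (sameCurve_deck₁ f g v))
    rw [H, zpow_add_one, Equiv.Perm.mul_apply]
    congr 1
    exact (onStrip_reflect n odd_one v).symm
  | pred k ih =>
    have e : deck₁ n (v.1 - n, 1 - v.2) = v := by ext <;> simp [deck₁]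
    have e' := onStrip_reflect n odd_one (v.1 - n, 1 - v.2)
    have H' := sameCurve_deck₁ f g (v.1 - n, 1 - v.2)
    rw [e] at H'
    refine .trans _ _ _ (ih (v := (v.1 - n, 1 - v.2)) ?_) H'
    rw [H, zpow_sub_one, Equiv.Perm.mul_apply]
    congr 1
    rw [Equiv.Perm.inv_eq_iff_eq]
    refine Eq.trans ?_ e'
    simp

omit hg in
-- Every left-out point lies over `t` or `t + 1`, which the inserted arc joins.
theorem sameCurve_of_not_mem {u v : ℤ × ℤ} (hu : u ∉ Set.range (spreadLift n t))
    (hv : v ∉ Set.range (spreadLift n t)) : sameCurve (insertCup t f) g u v := by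
  have h₀ : (t, 0) ∉ Set.range (spreadLift n t) := by
    rw [mem_range_spreadLift]
    rintro ⟨q, hq⟩
    exact spread_ne_zero q hq
  have h₁ : sameCurve (insertCup t f) g (t + 1, 0) (t, 0) := by
    have e : partnerLift n t (t, 0) = (t + 1, 0) := by
      ext
      · exact (congrArg Prod.fst (partner_zero (n := n) (t := t)) :)
      · rfl
    have H := sameLift_first (insertCup t f) g (t, 0)
    rw [liftMate_insertCup' h₀, e] at H
    exact H.sameCurve.symm
  have key : ∀ u, u ∉ Set.range (spreadLift n t) → sameCurve (insertCup t f) g u (t, 0) := by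
    intro u hu
    rw [mem_range_spreadLift, not_mem_range_spread] at hu
    obtain ⟨k, H | H⟩ := hu
    · exact sameCurve_of_onStrip (v := (t, 0)) _ _ H
    · exact .trans _ _ _ (sameCurve_of_onStrip (v := (t + 1, 0)) _ _ H) h₁
  exact .trans _ _ _ (key u hu) (.symm _ _ (key v hv))

/-- The curve runs through left-out points only, where the arcs are the inserted one and those of
`g`. This makes the factor independent of `f`. -/
theorem weight_insertCup {R : Type*} (d w x y z : R) (f f' : Diagram n) {u : ℤ × ℤ}
    (hu : u ∉ Set.range (spreadLift n t)) :
    Curve.weight d w x y z (Quotient.mk _ u : Curve (insertCup t f) g) =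
      Curve.weight d w x y z (Quotient.mk _ u : Curve (insertCup t f') g) := by
  have key : ∀ (f f' : Diagram n) γ,
      Curve.Invariant (Quotient.mk _ u : Curve (insertCup t f) g) γ →
        Curve.Invariant (Quotient.mk _ u : Curve (insertCup t f') g) γ := by
    rintro f f' γ ⟨v, hv, H⟩
    have hv' := sameCurve_not_mem hg (Quotient.exact hv.symm) hu
    exact ⟨v, Quotient.sound (sameCurve_of_not_mem hv' hu), sameLift_insertCup hg f f' hv' H⟩
  have key' := fun γ => Iff.intro (key f f' γ) (key f' f γ)
  classical
  exact if_congr (key' _) rfl <| if_congr (key' _) rfl <| if_congr (key' _) rfl <|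
    if_congr (key' _) rfl rfl

/-- If the marked points `t` and `t + 1` are joined to each other, capping off cuts off a closed
curve. -/
theorem IsCap.form_eq_mul {R : Type*} [CommRing R] (d w x y z : R) (hc : IsCap t g h)
    {u : ℤ × ℤ} (hu : u ∉ Set.range (spreadLift n t)) :
    form d w x y z (insertCup t f) g =
      Curve.weight d w x y z (Quotient.mk _ u : Curve (insertCup t f) g) *
        form d w x y z f h := by
  -- `none` stands for the curve that is cut off.
  let φ : Option (Curve f h) → Curve (insertCup t f) g :=
    fun o => o.elim (Quotient.mk _ u) (hc.curveMap f)
  have ne : ∀ c, hc.curveMap f c ≠ Quotient.mk _ u := by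
    intro c H
    obtain ⟨a, rfl⟩ := Quotient.exists_rep c
    exact sameCurve_not_mem hg (Quotient.exact H.symm) hu ⟨a, rfl⟩
  have hφ : Function.Bijective φ := by
    constructor
    · rintro (_ | c) (_ | c') H
      · rfl
      · exact absurd H.symm (ne c')
      · exact absurd H (ne c)
      · exact congrArg some (hc.curveMap_injective f H)
    · intro c
      obtain ⟨v, rfl⟩ := Quotient.exists_rep c
      by_cases hv : v ∈ Set.range (spreadLift n t)
      · obtain ⟨a, rfl⟩ := hv
        exact ⟨some (Quotient.mk _ a), rfl⟩
      · exact ⟨none, Quotient.sound (sameCurve_of_not_mem hu hv)⟩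
  unfold form
  rw [← Fintype.prod_bijective φ hφ (fun o => (φ o).weight d w x y z) _ fun _ => rfl,
    Fintype.prod_option]
  simp only [φ, Option.elim, hc.curveMap_weight]

end closed

end cap

/-! ### Factorization of the Gram matrix -/

/-- Capping off is adjoint to the insertion of an arc, up to a factor for each connection. -/
theorem exists_form_insertCup {R : Type*} [CommRing R] {n : ℕ} [NeZero n] (d w x y z : R) (t : ℤ)
    (g : Diagram (n + 1)) : ∃ (h : Diagram n) (c : R), ∀ f : Diagram n,
      form d w x y z (insertCup t f) g = c * form d w x y z f h := by
  obtain ⟨h, hc⟩ := exists_isCap t g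
  refine ⟨h, ?_⟩
  rcases mate_left_out t g with hg | hg
  · have hu : (t, 0) ∉ Set.range (spreadLift n t) := by
      rw [mem_range_spreadLift]
      rintro ⟨q, hq⟩
      exact spread_ne_zero q hq
    -- The weight is the same for every `f`; `h` merely serves as a representative.
    refine ⟨Curve.weight d w x y z (Quotient.mk _ (t, 0) : Curve (insertCup t h) g), fun f => ?_⟩
    rw [hc.form_eq_mul hg d w x y z hu, weight_insertCup hg d w x y z f h hu]
  · exact ⟨1, fun f => by rw [one_mul, hc.form_eq d w x y z hg]⟩

/-- A determinant is divisible by the determinant of a left factor of some of its rows. -/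
theorem det_dvd_det_of_rows {R M K : Type*} [CommRing R] [Fintype M] [DecidableEq M] [Fintype K]
    [DecidableEq K] (A : Matrix M M R) (B : Matrix K K R) (Q : Matrix K M R) {ι : K → M}
    (hι : Function.Injective ι) (h : ∀ k j, A (ι k) j = (B * Q) k j) : B.det ∣ A.det := by
  classical
  suffices ∀ {L : Type _} [Fintype L] [DecidableEq L] (e : K ⊕ L ≃ M),
      (∀ k, e (Sum.inl k) = ι k) → B.det ∣ A.det from
    this (((Equiv.ofInjective ι hι).sumCongr (Equiv.refl ((Set.range ι)ᶜ : Set M))).trans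
      (Equiv.Set.sumCompl (Set.range ι))) fun _ => rfl
  intro L _ _ e he
  -- After reordering, `A` is `diag(B, 1)` times `Q` stacked on the remaining rows of `A`.
  let C : Matrix (K ⊕ L) (K ⊕ L) R :=
    Matrix.fromRows (Q.submatrix id e) (A.submatrix (fun k => e (Sum.inr k)) e)
  have hA : A.submatrix e e = Matrix.fromBlocks B 0 0 (1 : Matrix L L R) * C := by
    rw [Matrix.fromBlocks_mul_fromRows]
    ext (i | i) j
    · simp [he, h, Matrix.mul_apply]
    · simp
  rw [← Matrix.det_submatrix_equiv_self e A, hA, Matrix.det_mul, Matrix.det_fromBlocks_zero₂₁,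
    Matrix.det_one, mul_one]
  exact dvd_mul_right _ _

open Classical in
theorem det_gramMatrix_sq_dvd {R : Type*} [CommRing R] (n : ℕ) [NeZero n] (d w x y z : R) :
    (gramMatrix n d w x y z).det ^ 2 ∣ (gramMatrix (n + 1) d w x y z).det := by
  choose cap c hcap using fun t g => exists_form_insertCup (n := n) d w x y z t g
  let G := gramMatrix n d w x y z
  -- Column `g` has the single entry `c t g`, in row `cap t g`.
  let Q : ℤ → Matrix (Diagram n) (Diagram (n + 1)) R := fun t =>
    Matrix.of fun f g => if f = cap t g then c t g else 0
  let ι : Diagram n ⊕ Diagram n → Diagram (n + 1) := Sum.elim (insertCup 0) (insertCup 1)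
  have hι : Function.Injective ι := by
    rintro (f | f) (g | g) H
    · exact congrArg _ (insertCup_injective H)
    · exact absurd H (insertCup_ne (t := 0) f g)
    · exact absurd H.symm (insertCup_ne (t := 0) g f)
    · exact congrArg _ (insertCup_injective H)
  have hQ : ∀ t f g, form d w x y z (insertCup t f) g = (G * Q t) f g := by
    intro t f g
    simp [Matrix.mul_apply, Q, G, gramMatrix, hcap, mul_comm]
  have key := det_dvd_det_of_rows (gramMatrix (n + 1) d w x y z) (Matrix.fromBlocks G 0 0 G)
    (Matrix.fromRows (Q 0) (Q 1)) hι (by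
      rw [Matrix.fromBlocks_mul_fromRows]
      rintro (f | f) g
      · simpa [gramMatrix, ι] using hQ 0 f g
      · simpa [gramMatrix, ι] using hQ 1 f g)
  rwa [Matrix.det_fromBlocks_zero₂₁, ← sq] at key

end MobiusGram

theorem mainTheorem7 {R : Type*} [CommRing R] (d w x y z : R) (hd : IsUnit (d ^ 2 - 1))
    (n : ℕ) (hn : 1 ≤ n) :
    (MobiusGram.gramDet (n - 1) d w x y z) ^ 2 ∣ MobiusGram.gramDet n d w x y z := by
  obtain _ | _ | n := n
  · omega
  -- For `n = 1` the divisor is `1` by the convention for the empty connection.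
  · simp [MobiusGram.gramDet]
  · exact MobiusGram.det_gramMatrix_sq_dvd (n + 1) d w x y z
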